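/- Let $\mathbb{K}=\mathbb{R}$ or $\mathbb{K}=\mathbb{C}$, let $\omega_1$ be the first uncountable ordinal, let $C([0,\omega_1])$ be the Banach space of continuous functions from the ordinal interval $[0,\omega_1]$ (with its order topology) to $\mathbb{K}$ with the supremum norm, and let $\mathscr{B}(C([0,\omega_1]))$ be the Banach algebra of bounded linear operators on it. For every $T\in\mathscr{B}(C([0,\omega_1]))$ there are unique scalars $T_{\alpha,\beta}$ $(\alpha,\beta\in[0,\omega_1])$ such that, for every $\alpha\in[0,\omega_1]$, $$\sum_{\beta\in[0,\omega_1]}|T_{\alpha,\beta}|<\infty\quad\text{and}\quad (Tf)(\alpha)=\sum_{\beta\in[0,\omega_1]}T_{\alpha,\beta}f(\beta)\quad\text{for all } f\in C([0,\omega_1]).$$ Let $\mathscr{M}$ be the Loy–Willis ideal, that is, the set of all $T\in\mathscr{B}(C([0,\omega_1]))$ whose final column $\alpha\mapsto T_{\alpha,\omega_1}$ is continuous at $\omega_1$. Then $\mathscr{M}$ is a two-sided ideal of codimension one in $\mathscr{B}(C([0,\omega_1]))$, it is a maximal two-sided ideal, and it is the only maximal two-sided ideal of $\mathscr{B}(C([0,\omega_1]))$.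 -/

import Mathlib

open scoped Ordinal

/-- The ordinal interval `[0, ω₁]`, a compact Hausdorff space; its topology (the subspace topology
from the ordinals) is its order topology. -/
abbrev OrdinalInterval : Type 1 := Set.Icc (0 : Ordinal.{0}) (ω₁ : Ordinal.{0})

/-- The end point `ω₁` of `[0, ω₁]`. -/
noncomputable def OrdinalInterval.last : OrdinalInterval := ⟨ω₁, zero_le, le_rfl⟩

theorem OrdinalInterval.orderTopology : OrderTopology OrdinalInterval := inferInstance

/-- The Banach algebra `B(C([0, ω₁]))` of bounded operators on `C([0, ω₁])`, where the scalar field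
`𝕜` is `ℝ` or `ℂ` and `C([0, ω₁])` carries the supremum norm. -/
abbrev BoundedOperators (𝕜 : Type*) [RCLike 𝕜] :=
  C(OrdinalInterval, 𝕜) →L[𝕜] C(OrdinalInterval, 𝕜)

/-- `a` is a matrix of the operator `T`: every row is absolutely summable, and
`T f (α) = ∑ β, a α β * f β` for all `f` and `α`. -/
def IsMatrixOf {𝕜 : Type*} [RCLike 𝕜] (T : BoundedOperators 𝕜)
    (a : OrdinalInterval → OrdinalInterval → 𝕜) : Prop :=
  ∀ α : OrdinalInterval, Summable (fun β => ‖a α β‖) ∧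
    ∀ f : C(OrdinalInterval, 𝕜), HasSum (fun β => a α β * f β) (T f α)

/-- The matrix `[T_{α, β}]` of the operator `T`; every operator has exactly one. -/
noncomputable def operatorMatrix {𝕜 : Type*} [RCLike 𝕜] (T : BoundedOperators 𝕜) :
    OrdinalInterval → OrdinalInterval → 𝕜 :=
  Classical.epsilon (IsMatrixOf T)

/-- The column of index `β` of the matrix of `T`, i.e. the function `α ↦ T_{α, β}`. -/
noncomputable def matrixColumn {𝕜 : Type*} [RCLike 𝕜] (T : BoundedOperators 𝕜)
    (β : OrdinalInterval) : OrdinalInterval → 𝕜 :=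
  fun α => operatorMatrix T α β

/-- The Loy–Willis set `M`: the operators whose final column is continuous at `ω₁`. -/
def loyWillis (𝕜 : Type*) [RCLike 𝕜] : Set (BoundedOperators 𝕜) :=
  {T | ContinuousAt (matrixColumn T OrdinalInterval.last) OrdinalInterval.last}

/-! Rows have countable support and `ω₁` has uncountable cofinality, so `T_{α,ω₁}` equals `T (1 -
1_[0,β]) α` for all `β < ω₁` large enough (`eventually_apply_eq_matrixColumn`). One `β` serves a
whole countable neighbourhood `[0,α]`, so the final column is continuous below `ω₁`, hence
eventually constant there: it is a continuous function plus a jump at `ω₁`. This jump is a character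
(`finalJump_mul`) whose kernel is the Loy–Willis set.

Conversely, let an ideal `J` contain `T` with jump 1. A nonzero ideal contains all rank-one
operators; subtracting two of them gives `T` the final row and column of the identity. A closing-off
argument makes `T f = f` on a closed unbounded set (`exists_gt_apply_eq`). That set is a copy of
`[0,ω₁]` with a continuous left inverse, so `S * T * R = 1` for composition operators `S`, `R`, and
`J = ⊤`. So every proper ideal lies in the kernel, which gives maximality and uniqueness together.
-/

namespace OrdinalInterval

open Set Topology Filter

/-! ### Topology of `[0,ω₁]` and eventual constancy of continuous functions. -/

theorem le_last (x : OrdinalInterval) : x ≤ last := x.2.2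

theorem isClopen_Iic (β : OrdinalInterval) : IsClopen (Iic β) := by
  refine ⟨_root_.isClosed_Iic, ?_⟩
  have : Iic β = Subtype.val ⁻¹' Iio (Order.succ β.1) := by
    ext x
    simp
  rw [this]
  exact isOpen_Iio.preimage continuous_subtype_val

theorem exists_lt_mem_of_countable {s : Set OrdinalInterval} (hs : s.Countable)
    (h : ∀ x ∈ s, x < last) : ∃ γ < last, ∀ x ∈ s, x < γ := by
  have := hs.to_subtype
  have hlt : (⨆ x : s, Order.succ x.1.1) < ω₁ :=
    Ordinal.iSup_lt_omega_one fun x =>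
      (Cardinal.isSuccLimit_omega 1).succ_lt (h x.1 x.2)
  refine ⟨⟨_, zero_le, hlt.le⟩, hlt, fun x hx => ?_⟩
  change x.1 < _
  exact (Order.lt_succ x.1).trans_le (Ordinal.le_iSup (fun x : s => Order.succ x.1.1) ⟨x, hx⟩)

theorem exists_gt_lt_last {x : OrdinalInterval} (hx : x < last) : ∃ y < last, x < y := by
  simpa using exists_lt_mem_of_countable (countable_singleton x) (by simpa using hx)

theorem zero_lt_last : (⟨0, le_rfl, zero_le⟩ : OrdinalInterval) < last := by
  change (0 : Ordinal) < ω₁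
  exact Ordinal.omega_pos 1

theorem exists_isLUB_lt_last (u : ℕ → OrdinalInterval) (hu : ∀ n, u n < last) :
    ∃ ξ < last, (∀ n, u n ≤ ξ) ∧ ∀ α < ξ, ∃ n, α < u n := by
  have hlt : (⨆ n, (u n).1) < ω₁ := Ordinal.iSup_lt_omega_one hu
  refine ⟨⟨_, zero_le, hlt.le⟩, hlt, fun n => Ordinal.le_iSup (fun n => (u n).1) n, fun α hα => ?_⟩
  exact Ordinal.lt_iSup_iff.1 (show α.1 < _ from hα)

/-- Below `ω₁`, there are arbitrarily large points closed under a given function. -/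
theorem exists_closed_under (F : OrdinalInterval → OrdinalInterval)
    (hF : ∀ γ < last, F γ < last) {γ₀ : OrdinalInterval} (h₀ : γ₀ < last) :
    ∃ ξ < last, γ₀ < ξ ∧ ∀ α < ξ, ∃ γ < ξ, α < γ ∧ F γ < ξ := by
  have hG : ∀ γ : OrdinalInterval, ∃ γ', γ < last → γ' < last ∧ γ < γ' ∧ F γ < γ' := by
    intro γ
    by_cases h : γ < last
    · obtain ⟨γ', h1, h2⟩ := exists_gt_lt_last (max_lt h (hF γ h))
      exact ⟨γ', fun _ => ⟨h1, (le_max_left _ _).trans_lt h2, (le_max_right _ _).trans_lt h2⟩⟩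
    · exact ⟨γ, fun h' => absurd h' h⟩
  choose G hG using hG
  have hu : ∀ n, G^[n] γ₀ < last := by
    intro n
    induction n with
    | zero => exact h₀
    | succ n ih =>
      rw [Function.iterate_succ_apply']
      exact (hG _ ih).1
  have hs : ∀ n, G^[n] γ₀ < G^[n + 1] γ₀ ∧ F (G^[n] γ₀) < G^[n + 1] γ₀ := by
    intro n
    rw [Function.iterate_succ_apply']
    exact (hG _ (hu n)).2
  obtain ⟨ξ, h1, h2, h3⟩ := exists_isLUB_lt_last (fun n => G^[n] γ₀) hu
  refine ⟨ξ, h1, (hs 0).1.trans_le (h2 1), fun α hα => ?_⟩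
  obtain ⟨n, hn⟩ := h3 α hα
  exact ⟨G^[n] γ₀, (hs n).1.trans_le (h2 _), hn, (hs n).2.trans_le (h2 _)⟩

theorem exists_Ioc_subset_of_mem_nhds {β γ : OrdinalInterval} (h : γ < β)
    {s : Set OrdinalInterval} (hs : s ∈ 𝓝 β) : ∃ δ < β, Ioc δ β ⊆ s :=
  _root_.exists_Ioc_subset_of_mem_nhds hs ⟨γ, h⟩

theorem eventually_eq_of_continuousAt_last {X : Type*} [MetricSpace X]
    {f : OrdinalInterval → X} (hf : ContinuousAt f last) :
    ∃ γ < last, ∀ α, γ ≤ α → f α = f last := by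
  have h : ∀ n : ℕ, ∃ δ < last, Ioc δ last ⊆ f ⁻¹' Metric.ball (f last) (1 / ((n : ℝ) + 1)) :=
    fun n => exists_Ioc_subset_of_mem_nhds zero_lt_last
      (hf (Metric.ball_mem_nhds _ Nat.one_div_pos_of_nat))
  choose δ hδ hδ' using h
  obtain ⟨γ, hγ, hγ'⟩ := exists_lt_mem_of_countable (countable_range δ) (by simpa using hδ)
  refine ⟨γ, hγ, fun α hα => eq_of_forall_dist_le fun ε hε => ?_⟩
  obtain ⟨n, hn⟩ := exists_nat_one_div_lt hε
  exact (lt_trans (hδ' n ⟨(hγ' _ ⟨n, rfl⟩).trans_le hα, le_last α⟩) hn).le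

/-- If bad pairs `A γ, B γ` existed above every `γ`, closing off under them would give `ξ < ω₁` with
bad pairs arbitrarily close below it, against continuity at `ξ`. -/
theorem eventually_dist_le_of_continuousAt {X : Type*} [MetricSpace X]
    {k : OrdinalInterval → X} (hk : ∀ α < last, ContinuousAt k α) {ε : ℝ} (hε : 0 < ε) :
    ∃ γ < last, ∀ α β, γ < α → γ < β → α < last → β < last → dist (k α) (k β) ≤ ε := by
  by_contra! hcon
  have hA : ∀ γ : OrdinalInterval, ∃ α β, γ < last →
      γ < α ∧ γ < β ∧ α < last ∧ β < last ∧ ε < dist (k α) (k β) := by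
    intro γ
    by_cases h : γ < last
    · obtain ⟨α, β, h⟩ := hcon γ h
      exact ⟨α, β, fun _ => h⟩
    · exact ⟨γ, γ, fun h' => absurd h' h⟩
  choose A B hAB using hA
  obtain ⟨ξ, hξ, hξ₀, hcl⟩ := exists_closed_under (fun γ => max (A γ) (B γ))
    (fun γ hγ => max_lt (hAB γ hγ).2.2.1 (hAB γ hγ).2.2.2.1) zero_lt_last
  obtain ⟨δ, hδ, hδ'⟩ := exists_Ioc_subset_of_mem_nhds hξ₀
    (hk ξ hξ (Metric.ball_mem_nhds (k ξ) (half_pos hε)))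
  obtain ⟨γ, hγξ, hδγ, hγ⟩ := hcl δ hδ
  obtain ⟨h1, h2, -, -, h5⟩ := hAB γ (hγξ.trans hξ)
  have hA : dist (k (A γ)) (k ξ) < ε / 2 :=
    hδ' ⟨hδγ.trans h1, (lt_of_le_of_lt (le_max_left _ _) hγ).le⟩
  have hB : dist (k (B γ)) (k ξ) < ε / 2 :=
    hδ' ⟨hδγ.trans h2, (lt_of_le_of_lt (le_max_right _ _) hγ).le⟩
  linarith [dist_triangle_right (k (A γ)) (k (B γ)) (k ξ)]

theorem exists_eventually_eq_of_continuousAt {X : Type*} [MetricSpace X]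
    {k : OrdinalInterval → X} (hk : ∀ α < last, ContinuousAt k α) :
    ∃ c, ∃ γ < last, ∀ α, γ ≤ α → α < last → k α = c := by
  have h := fun n : ℕ => eventually_dist_le_of_continuousAt hk (Nat.one_div_pos_of_nat (n := n))
  choose δ hδ hδ' using h
  obtain ⟨γ, hγ, hγ'⟩ := exists_lt_mem_of_countable (countable_range δ) (by simpa using hδ)
  refine ⟨k γ, γ, hγ, fun α hα hα' => eq_of_forall_dist_le fun ε hε => ?_⟩
  obtain ⟨n, hn⟩ := exists_nat_one_div_lt hε
  have hn' := hγ' _ ⟨n, rfl⟩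
  exact (hδ' n α γ (hn'.trans_le hα) hn' hα' hγ).trans hn.le

/-- The indicator function of `[0, β]`. -/
noncomputable def initialIndicator (𝕜 : Type*) [RCLike 𝕜] (β : OrdinalInterval) :
    C(OrdinalInterval, 𝕜) where
  toFun x := if x ≤ β then 1 else 0
  continuous_toFun := by
    refine continuous_if (fun a ha => ?_) continuousOn_const continuousOn_const
    have : frontier {x | x ≤ β} = ∅ := (isClopen_Iic β).frontier_eq
    simp [this] at ha

theorem initialIndicator_apply (𝕜 : Type*) [RCLike 𝕜] (β x : OrdinalInterval) :
    initialIndicator 𝕜 β x = if x ≤ β then 1 else 0 := rfl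

theorem initialIndicator_last (𝕜 : Type*) [RCLike 𝕜] : initialIndicator 𝕜 last = 1 := by
  ext x
  simp [initialIndicator_apply, le_last]

/-! ### Functionals as absolutely summable families. -/

section Functional

variable {𝕜 : Type*} [RCLike 𝕜]

/-- Transfinite induction: `f` is within `ε` of `f β` on some `(γ,β]`, so `f β` times the indicator
of `(γ,β]` is added to the approximant for `γ`. That one vanishes beyond `γ`, so errors do not
accumulate. -/
theorem exists_mem_span_initialIndicator (f : C(OrdinalInterval, 𝕜)) {ε : ℝ} (hε : 0 < ε)
    (β : OrdinalInterval) : ∃ s ∈ Submodule.span 𝕜 (range (initialIndicator 𝕜)),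
      (∀ x ≤ β, ‖f x - s x‖ ≤ ε) ∧ ∀ x, β < x → s x = 0 := by
  induction β using WellFoundedLT.induction with
  | ind β ih =>
  by_cases h : ∃ γ, γ < β
  · obtain ⟨γ₀, hγ₀⟩ := h
    obtain ⟨γ, hγ, hγ'⟩ := exists_Ioc_subset_of_mem_nhds hγ₀
      (f.continuous.continuousAt (Metric.ball_mem_nhds (f β) hε))
    obtain ⟨s, hs, h1, h2⟩ := ih γ hγ
    refine ⟨s + f β • (initialIndicator 𝕜 β - initialIndicator 𝕜 γ), add_mem hs
      (Submodule.smul_mem _ _ (sub_mem (Submodule.subset_span ⟨β, rfl⟩)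
        (Submodule.subset_span ⟨γ, rfl⟩))), fun x hx => ?_, fun x hx => ?_⟩
    · rcases le_or_gt x γ with hxγ | hxγ
      · simpa [initialIndicator_apply, hx, hxγ] using h1 x hxγ
      · have := hγ' ⟨hxγ, hx⟩
        simp only [mem_preimage, Metric.mem_ball, dist_eq_norm] at this
        simpa [initialIndicator_apply, hx, hxγ.not_ge, h2 x hxγ] using this.le
    · simp [initialIndicator_apply, hx.not_ge, (hγ.trans hx).not_ge, h2 x (hγ.trans hx)]
  · refine ⟨f β • initialIndicator 𝕜 β, Submodule.smul_mem _ _ (Submodule.subset_span ⟨β, rfl⟩),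
      fun x hx => ?_, fun x hx => ?_⟩
    · obtain rfl : x = β := hx.eq_of_not_lt fun h' => h ⟨x, h'⟩
      simp [initialIndicator_apply, hε.le]
    · simp [initialIndicator_apply, hx.not_ge]

theorem dense_span_initialIndicator :
    Dense (Submodule.span 𝕜 (range (initialIndicator 𝕜)) : Set C(OrdinalInterval, 𝕜)) := by
  intro f
  rw [Metric.mem_closure_iff]
  intro ε hε
  obtain ⟨s, hs, h1, -⟩ := exists_mem_span_initialIndicator f (half_pos hε) last
  refine ⟨s, hs, lt_of_le_of_lt ?_ (half_lt_self hε)⟩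
  rw [ContinuousMap.dist_le (half_pos hε).le]
  exact fun x => by simpa [dist_eq_norm] using h1 x (le_last x)

theorem continuousLinearMap_ext {E : Type*} [NormedAddCommGroup E] [NormedSpace 𝕜 E]
    {μ ν : C(OrdinalInterval, 𝕜) →L[𝕜] E}
    (h : ∀ β, μ (initialIndicator 𝕜 β) = ν (initialIndicator 𝕜 β)) : μ = ν :=
  ContinuousLinearMap.ext_on dense_span_initialIndicator (by rintro _ ⟨β, rfl⟩; exact h β)

/-- The total variation of the functional `μ` on the interval `[0, β]`. -/
noncomputable def variation (μ : C(OrdinalInterval, 𝕜) →L[𝕜] 𝕜) (β : OrdinalInterval) : ℝ :=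
  sSup {r | ∃ h : C(OrdinalInterval, 𝕜), ‖h‖ ≤ 1 ∧ (∀ x, β < x → h x = 0) ∧ RCLike.re (μ h) = r}

variable (μ : C(OrdinalInterval, 𝕜) →L[𝕜] 𝕜)

theorem le_variation {β : OrdinalInterval} {h : C(OrdinalInterval, 𝕜)} (h1 : ‖h‖ ≤ 1)
    (h2 : ∀ x, β < x → h x = 0) : RCLike.re (μ h) ≤ variation μ β := by
  refine le_csSup ⟨‖μ‖, ?_⟩ ⟨h, h1, h2, rfl⟩
  rintro _ ⟨g, hg, -, rfl⟩
  exact (RCLike.re_le_norm _).trans (μ.unit_le_opNorm g hg)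

theorem variation_nonneg (β : OrdinalInterval) : 0 ≤ variation μ β := by
  simpa using le_variation μ (β := β) (h := 0) (by simp) (by simp)

theorem norm_apply_initialIndicator_le (β : OrdinalInterval) :
    ‖μ (initialIndicator 𝕜 β)‖ ≤ variation μ β := by
  obtain ⟨c, hc, hc'⟩ := RCLike.exists_norm_eq_mul_self (μ (initialIndicator 𝕜 β))
  have := le_variation μ (β := β) (h := c • initialIndicator 𝕜 β) ?_ ?_
  · rwa [map_smul, smul_eq_mul, ← hc', RCLike.ofReal_re] at this
  · refine (ContinuousMap.norm_le _ zero_le_one).2 fun x => ?_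
    simp only [ContinuousMap.smul_apply, initialIndicator_apply]
    split_ifs <;> simp [hc]
  · intro x hx
    simp [initialIndicator_apply, hx.not_ge]

/-- A test function carried by `[0,γ]` stays in the unit ball when a unimodular multiple of the
indicator of `(γ,β]` is added, the supports being disjoint. -/
theorem variation_add_norm_sub_le {β γ : OrdinalInterval} (hγβ : γ ≤ β) :
    variation μ γ + ‖μ (initialIndicator 𝕜 β) - μ (initialIndicator 𝕜 γ)‖ ≤ variation μ β := by
  rw [← le_sub_iff_add_le]
  refine csSup_le ⟨0, 0, by simp⟩ ?_
  rintro _ ⟨h, h1, h2, rfl⟩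
  rw [le_sub_iff_add_le]
  obtain ⟨c, hc, hc'⟩ :=
    RCLike.exists_norm_eq_mul_self (μ (initialIndicator 𝕜 β) - μ (initialIndicator 𝕜 γ))
  have := le_variation μ (β := β)
    (h := h + c • (initialIndicator 𝕜 β - initialIndicator 𝕜 γ)) ?_ ?_
  · rwa [map_add, map_smul, smul_eq_mul, map_sub, ← hc', map_add, RCLike.ofReal_re] at this
  · refine (ContinuousMap.norm_le _ zero_le_one).2 fun x => ?_
    simp only [ContinuousMap.add_apply, ContinuousMap.smul_apply, ContinuousMap.sub_apply,
      initialIndicator_apply]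
    rcases le_or_gt x γ with hx | hx
    · simpa [hx, hx.trans hγβ] using (h.norm_coe_le_norm x).trans h1
    · rw [h2 x hx]
      by_cases hxβ : x ≤ β <;> simp [hx.not_ge, hxβ, hc]
  · intro x hx
    simp [initialIndicator_apply, hx.not_ge, (hγβ.trans_lt hx).not_ge, h2 x (hγβ.trans_lt hx)]

theorem variation_mono : Monotone (variation μ) := fun _ _ h =>
  (le_add_of_nonneg_right (norm_nonneg _)).trans (variation_add_norm_sub_le μ h)

/-- The total variation of `μ` on `[0, β)`. -/
noncomputable def leftVariation (β : OrdinalInterval) : ℝ := ⨆ γ : Iio β, variation μ γ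

theorem bddAbove_range_variation (β : OrdinalInterval) :
    BddAbove (range fun γ : Iio β => variation μ γ) :=
  ⟨variation μ β, by rintro _ ⟨γ, rfl⟩; exact variation_mono μ (le_of_lt γ.2)⟩

theorem variation_le_leftVariation {β γ : OrdinalInterval} (h : γ < β) :
    variation μ γ ≤ leftVariation μ β :=
  le_ciSup (bddAbove_range_variation μ β) ⟨γ, h⟩

/-- Increments of `γ ↦ μ 1_[0,γ]` are dominated by those of the monotone bounded variation, so the
net is Cauchy. At `β = 0` the limit is along `⊥` and says nothing; the last clause fixes `L = 0`
there. -/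
theorem exists_leftLimit (β : OrdinalInterval) : ∃ L : 𝕜,
    ‖μ (initialIndicator 𝕜 β) - L‖ ≤ variation μ β - leftVariation μ β ∧
    Tendsto (fun γ : Iio β => μ (initialIndicator 𝕜 γ)) atTop (𝓝 L) ∧
    (IsEmpty (Iio β) → L = 0) := by
  rcases isEmpty_or_nonempty (Iio β) with h | h
  · refine ⟨0, ?_, ?_, fun _ => rfl⟩
    · simpa [leftVariation] using norm_apply_initialIndicator_le μ β
    · rw [filter_eq_bot_of_isEmpty atTop]
      exact tendsto_bot
  · have hV : Tendsto (fun γ : Iio β => variation μ γ) atTop (𝓝 (leftVariation μ β)) :=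
      tendsto_atTop_ciSup (fun _ _ h => variation_mono μ h) (bddAbove_range_variation μ β)
    have hle : ∀ γ δ : Iio β, dist (μ (initialIndicator 𝕜 γ)) (μ (initialIndicator 𝕜 δ)) ≤
        dist (variation μ γ) (variation μ δ) := by
      intro γ δ
      wlog hγδ : δ ≤ γ generalizing γ δ
      · rw [dist_comm, dist_comm (variation μ γ)]
        exact this δ γ (le_of_not_ge hγδ)
      · rw [dist_eq_norm, Real.dist_eq]
        refine le_trans ?_ (le_abs_self _)
        linarith [variation_add_norm_sub_le μ (show δ.1 ≤ γ.1 from hγδ)]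
    have hC : CauchySeq fun γ : Iio β => μ (initialIndicator 𝕜 γ) := by
      rw [Metric.cauchySeq_iff]
      intro ε hε
      obtain ⟨N, hN⟩ := Metric.cauchySeq_iff.1 hV.cauchySeq ε hε
      exact ⟨N, fun m hm n hn => (hle m n).trans_lt (hN m hm n hn)⟩
    obtain ⟨L, hL⟩ := cauchySeq_tendsto_of_complete hC
    refine ⟨L, ?_, hL, fun h' => absurd h (not_nonempty_iff.2 h')⟩
    refine le_of_tendsto_of_tendsto (tendsto_const_nhds.sub hL).norm
      (tendsto_const_nhds.sub hV) (Eventually.of_forall fun γ => ?_)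
    simp only
    linarith [variation_add_norm_sub_le μ (le_of_lt γ.2)]

theorem sum_jump_le (S : Finset OrdinalInterval) : ∀ β, (∀ x ∈ S, x ≤ β) →
    ∑ x ∈ S, (variation μ x - leftVariation μ x) ≤ variation μ β := by
  induction S using Finset.induction_on_max with
  | empty => exact fun β _ => by simpa using variation_nonneg μ β
  | insert m S hm ih =>
    intro β hβ
    rw [Finset.sum_insert fun h => lt_irrefl _ (hm m h)]
    -- The earlier jumps are already counted in the variation strictly before the maximum `m`.
    have h1 : ∑ x ∈ S, (variation μ x - leftVariation μ x) ≤ leftVariation μ m := by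
      rcases S.eq_empty_or_nonempty with rfl | hS
      · exact Real.iSup_nonneg fun γ : Iio m => variation_nonneg μ γ
      · exact (ih _ fun x hx => S.le_max' x hx).trans
          (variation_le_leftVariation μ (hm _ (S.max'_mem hS)))
    linarith [variation_mono μ (hβ m (Finset.mem_insert_self _ _))]

/-- By induction and dominated convergence, the left limit `L β` is the sum of `a` over `[0,β)`; the
jump `a β` supplies the last term. -/
theorem apply_initialIndicator_eq_tsum {a L : OrdinalInterval → 𝕜}
    (ha : Summable fun x => ‖a x‖)
    (haL : ∀ β, μ (initialIndicator 𝕜 β) = L β + a β)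
    (hL : ∀ β, Tendsto (fun γ : Iio β => μ (initialIndicator 𝕜 γ)) atTop (𝓝 (L β)))
    (hL₀ : ∀ β, IsEmpty (Iio β) → L β = 0) (β : OrdinalInterval) :
    μ (initialIndicator 𝕜 β) = ∑' x, a x * initialIndicator 𝕜 β x := by
  induction β using WellFoundedLT.induction with
  | ind β ih =>
  have hlt : L β = ∑' x, if x < β then a x else 0 := by
    rcases isEmpty_or_nonempty (Iio β) with h | h
    · have : ∀ x, ¬ x < β := fun x hx => h.false ⟨x, hx⟩
      simp [hL₀ β h, this]
    · refine tendsto_nhds_unique (hL β) ?_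
      have : (fun γ : Iio β => μ (initialIndicator 𝕜 γ)) =
          fun γ : Iio β => ∑' x, a x * initialIndicator 𝕜 γ x := funext fun γ => ih γ γ.2
      rw [this]
      refine tendsto_tsum_of_dominated_convergence ha (fun x => ?_)
        (Eventually.of_forall fun γ x => ?_)
      · refine tendsto_const_nhds.congr' ?_
        by_cases hx : x < β
        · filter_upwards [eventually_ge_atTop (⟨x, hx⟩ : Iio β)] with γ hγ
          have : x ≤ γ.1 := hγ
          simp [initialIndicator_apply, hx, this]
        · refine Eventually.of_forall fun γ => ?_
          have : ¬ x ≤ γ.1 := fun h' => hx (h'.trans_lt γ.2)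
          simp [initialIndicator_apply, hx, this]
      · simp only [initialIndicator_apply]
        split_ifs <;> simp
  have h1 : Summable fun x => if x < β then a x else 0 :=
    Summable.of_norm_bounded ha fun x => by split_ifs <;> simp
  have h2 := h1.hasSum.add (hasSum_ite_eq β (a β))
  rw [haL, hlt, ← h2.tsum_eq]
  refine tsum_congr fun x => ?_
  rcases lt_trichotomy x β with h | rfl | h
  · simp [initialIndicator_apply, h, h.le, h.ne]
  · simp [initialIndicator_apply]
  · simp [initialIndicator_apply, h.not_gt, h.not_ge, h.ne']

/-- An absolutely summable family defines a functional on `C([0, ω₁])`. -/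
theorem exists_continuousLinearMap_hasSum {a : OrdinalInterval → 𝕜}
    (ha : Summable fun x => ‖a x‖) : ∃ ν : C(OrdinalInterval, 𝕜) →L[𝕜] 𝕜,
      ∀ f, HasSum (fun x => a x * f x) (ν f) := by
  have hle : ∀ (f : C(OrdinalInterval, 𝕜)) x, ‖a x * f x‖ ≤ ‖a x‖ * ‖f‖ := fun f x => by
    rw [norm_mul]
    exact mul_le_mul_of_nonneg_left (f.norm_coe_le_norm x) (norm_nonneg _)
  have hs : ∀ f : C(OrdinalInterval, 𝕜), Summable fun x => a x * f x := fun f =>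
    Summable.of_norm_bounded (ha.mul_right ‖f‖) (hle f)
  let ν : C(OrdinalInterval, 𝕜) →ₗ[𝕜] 𝕜 :=
    { toFun := fun f => ∑' x, a x * f x
      map_add' := fun f g => by
        rw [← (hs f).tsum_add (hs g)]
        exact tsum_congr fun x => mul_add _ _ _
      map_smul' := fun c f => by
        rw [RingHom.id_apply, smul_eq_mul, ← tsum_mul_left]
        exact tsum_congr fun x => mul_left_comm _ _ _ }
  refine ⟨ν.mkContinuous (∑' x, ‖a x‖) fun f => ?_, fun f => (hs f).hasSum⟩
  rw [← tsum_mul_right]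
  exact tsum_of_norm_bounded (ha.mul_right ‖f‖).hasSum (hle f)

theorem hasSum_coeff_unique {a b : OrdinalInterval → 𝕜}
    (h : ∀ β, ∃ c, HasSum (fun x => a x * initialIndicator 𝕜 β x) c ∧
      HasSum (fun x => b x * initialIndicator 𝕜 β x) c) : a = b := by
  funext β
  induction β using WellFoundedLT.induction with
  | ind β ih =>
  obtain ⟨c, h1, h2⟩ := h β
  have h3 := h1.sub h2
  rw [sub_self] at h3
  have h4 := hasSum_single (f := fun x => a x * initialIndicator 𝕜 β x -
    b x * initialIndicator 𝕜 β x) β fun x hx => by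
      rcases hx.lt_or_gt with h | h
      · rw [ih x h, sub_self]
      · simp [initialIndicator_apply, h.not_ge]
  have h5 := h4.unique h3
  simpa [initialIndicator_apply, sub_eq_zero] using h5

/-- Rudin's theorem for `[0, ω₁]`: every functional on `C([0, ω₁])` is given by an absolutely
summable family. -/
theorem exists_summable_hasSum : ∃ a : OrdinalInterval → 𝕜,
    Summable (fun x => ‖a x‖) ∧ ∀ f, HasSum (fun x => a x * f x) (μ f) := by
  -- The coefficient at `x` is the jump of `β ↦ μ 1_[0,β]` at `x`.
  choose L hL1 hL2 hL3 using exists_leftLimit μ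
  have ha : Summable fun x => ‖μ (initialIndicator 𝕜 x) - L x‖ :=
    summable_of_sum_le (c := variation μ last) (fun _ => norm_nonneg _) fun S =>
      (Finset.sum_le_sum fun x _ => hL1 x).trans (sum_jump_le μ S last fun x _ => le_last x)
  obtain ⟨ν, hν⟩ := exists_continuousLinearMap_hasSum ha
  have hμν : μ = ν := continuousLinearMap_ext fun β => by
    rw [apply_initialIndicator_eq_tsum μ ha (fun β => by ring) hL2 hL3 β, (hν _).tsum_eq]
  exact ⟨_, ha, hμν ▸ hν⟩

end Functional

end OrdinalInterval

open OrdinalInterval in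
theorem existsUnique_isMatrixOf {𝕜 : Type*} [RCLike 𝕜] (T : BoundedOperators 𝕜) :
    ∃! a : OrdinalInterval → OrdinalInterval → 𝕜, IsMatrixOf T a := by
  choose a ha using fun α => exists_summable_hasSum ((ContinuousMap.evalCLM 𝕜 α).comp T)
  refine ⟨a, ha, fun b hb => ?_⟩
  funext α
  exact hasSum_coeff_unique fun β => ⟨_, (hb α).2 _, (ha α).2 _⟩

theorem isMatrixOf_operatorMatrix {𝕜 : Type*} [RCLike 𝕜] (T : BoundedOperators 𝕜) :
    IsMatrixOf T (operatorMatrix T) :=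
  Classical.epsilon_spec (existsUnique_isMatrixOf T).exists

namespace OrdinalInterval

open Set Topology Filter

/-! ### The final column and its jump. -/

theorem countable_Iic_of_lt_last {α : OrdinalInterval} (hα : α < last) : (Iic α).Countable := by
  have h : (Iio (Order.succ α.1)).Countable := by
    rw [← Cardinal.le_aleph0_iff_set_countable, Cardinal.mk_Iio_ordinal, Cardinal.lift_le_aleph0,
      ← Cardinal.lt_aleph_one_iff, ← Cardinal.lt_omega_iff_card_lt]
    exact (Cardinal.isSuccLimit_omega 1).succ_lt hα
  have : Iic α = Subtype.val ⁻¹' Iio (Order.succ α.1) := by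
    ext x
    simp
  rw [this]
  exact h.preimage Subtype.val_injective

theorem eventually_nhdsLT_last_iff {p : OrdinalInterval → Prop} :
    (∀ᶠ β in 𝓝[<] last, p β) ↔ ∃ γ < last, ∀ β, γ ≤ β → β < last → p β := by
  refine (mem_nhdsLT_iff_exists_Ioo_subset' zero_lt_last).trans
    ⟨fun ⟨l, hl, h⟩ => ?_, fun ⟨γ, hγ, h⟩ => ⟨γ, hγ, fun β hβ => h β hβ.1.le hβ.2⟩⟩
  obtain ⟨γ, hγ, hlγ⟩ := exists_gt_lt_last hl
  exact ⟨γ, hγ, fun β h1 h2 => h ⟨hlγ.trans_le h1, h2⟩⟩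

instance neBot_nhdsLT_last : (𝓝[<] last).NeBot := by
  rw [neBot_iff]
  intro h
  have : ∀ᶠ β in 𝓝[<] last, False := by simp [h]
  obtain ⟨γ, hγ, h⟩ := eventually_nhdsLT_last_iff.1 this
  exact h γ le_rfl hγ

/-- Allows a single `β < ω₁` to meet countably many conditions, each valid for `β` near `ω₁`. -/
instance countableInterFilter_nhdsLT_last : CountableInterFilter (𝓝[<] last) := by
  refine ⟨fun S hS h => ?_⟩
  have h' : ∀ s : Set OrdinalInterval, ∃ γ < last, s ∈ S → ∀ β, γ ≤ β → β < last → β ∈ s := by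
    intro s
    by_cases hs : s ∈ S
    · obtain ⟨γ, h1, h2⟩ := eventually_nhdsLT_last_iff.1 (h s hs)
      exact ⟨γ, h1, fun _ => h2⟩
    · exact ⟨_, zero_lt_last, fun h => absurd h hs⟩
  choose F hF hF' using h'
  obtain ⟨γ, hγ, hγ'⟩ := exists_lt_mem_of_countable (hS.image F)
    (by rintro _ ⟨s, -, rfl⟩; exact hF s)
  exact eventually_nhdsLT_last_iff.2 ⟨γ, hγ, fun β h1 h2 s hs =>
    hF' s hs β ((hγ' _ ⟨s, hs, rfl⟩).le.trans h1) h2⟩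

/-- `g` and `h` take their values at `ω₁` already at some point below it; comparing the identity at
both points isolates `c` and `d`. -/
theorem eq_of_ite_add {X : Type*} [NormedAddCommGroup X] {g h : OrdinalInterval → X}
    (hg : ContinuousAt g last) (hh : ContinuousAt h last) {c d : X}
    (H : ∀ α, g α + (if α = last then c else 0) = h α + if α = last then d else 0) : c = d := by
  obtain ⟨γ₁, h1, h1'⟩ := eventually_eq_of_continuousAt_last hg
  obtain ⟨γ₂, h2, h2'⟩ := eventually_eq_of_continuousAt_last hh
  have hγ := H (max γ₁ γ₂)
  have hl := H last
  rw [h1' _ (le_max_left _ _), h2' _ (le_max_right _ _), if_neg (max_lt h1 h2).ne,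
    if_neg (max_lt h1 h2).ne, add_zero, add_zero] at hγ
  simpa [hγ] using hl

variable {𝕜 : Type*} [RCLike 𝕜]

theorem eventually_row_eq_zero (T : BoundedOperators 𝕜) (α : OrdinalInterval) :
    ∃ γ < last, ∀ x, γ ≤ x → x < last → operatorMatrix T α x = 0 := by
  have h := (isMatrixOf_operatorMatrix T α).1.of_norm.countable_support
  obtain ⟨γ, hγ, h'⟩ := exists_lt_mem_of_countable (h.mono inter_subset_left)
    (s := _ ∩ Iio last) fun x hx => hx.2
  refine ⟨γ, hγ, fun x hx hx' => ?_⟩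
  by_contra hne
  exact (h' x ⟨hne, hx'⟩).not_ge hx

theorem eventually_apply_eq_matrixColumn (T : BoundedOperators 𝕜) (α : OrdinalInterval) :
    ∀ᶠ β in 𝓝[<] last, T (1 - initialIndicator 𝕜 β) α = matrixColumn T last α := by
  obtain ⟨γ, hγ, h⟩ := eventually_row_eq_zero T α
  refine eventually_nhdsLT_last_iff.2 ⟨γ, hγ, fun β h1 h2 => ?_⟩
  refine ((isMatrixOf_operatorMatrix T α).2 _).unique ?_
  convert hasSum_single last fun x hx => ?_ using 1
  · simp [initialIndicator_apply, h2.not_ge, matrixColumn]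
  -- Below `ω₁`, the function vanishes up to `β` and the row vanishes after it.
  · rcases le_or_gt x β with hxβ | hxβ
    · simp [initialIndicator_apply, hxβ]
    · rw [h x (h1.trans hxβ.le) (lt_of_le_of_ne (le_last x) hx), zero_mul]

theorem matrixColumn_last_eq {T : BoundedOperators 𝕜} {α : OrdinalInterval} {c : 𝕜}
    (h : ∀ᶠ β in 𝓝[<] last, T (1 - initialIndicator 𝕜 β) α = c) :
    matrixColumn T last α = c := by
  obtain ⟨β, h1, h2⟩ := (h.and (eventually_apply_eq_matrixColumn T α)).exists
  exact h2.symm.trans h1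

theorem continuousAt_matrixColumn_last (T : BoundedOperators 𝕜) {α : OrdinalInterval}
    (hα : α < last) : ContinuousAt (matrixColumn T last) α := by
  obtain ⟨β, hβ⟩ := ((eventually_countable_ball (countable_Iic_of_lt_last hα)).2
    fun x _ => eventually_apply_eq_matrixColumn T x).exists
  refine (T (1 - initialIndicator 𝕜 β)).continuous.continuousAt.congr ?_
  filter_upwards [(isClopen_Iic α).isOpen.mem_nhds self_mem_Iic] with x hx using hβ x hx

/-- The final column of an operator is continuous up to a jump at `ω₁`. -/
theorem exists_matrixColumn_last_eq (T : BoundedOperators 𝕜) : ∃ c : 𝕜,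
    ∃ g : C(OrdinalInterval, 𝕜), ∀ α, matrixColumn T last α = g α + if α = last then c else 0 := by
  obtain ⟨c, γ, hγ, h⟩ :=
    exists_eventually_eq_of_continuousAt fun α hα => continuousAt_matrixColumn_last T hα
  refine ⟨matrixColumn T last last - c, ⟨Function.update (matrixColumn T last) last c, ?_⟩,
    fun α => ?_⟩
  · rw [continuous_iff_continuousAt]
    intro α
    rcases (le_last α).lt_or_eq with hα | rfl
    · refine (continuousAt_matrixColumn_last T hα).congr ?_
      filter_upwards [(isClopen_Iic α).isOpen.mem_nhds self_mem_Iic] with x hx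
      rw [Function.update_of_ne (lt_of_le_of_lt hx hα).ne]
    · refine continuousAt_const (y := c) |>.congr ?_
      filter_upwards [(isClopen_Iic γ).compl.isOpen.mem_nhds (mem_compl (not_le.2 hγ))] with x hx
      rcases (le_last x).lt_or_eq with hx' | rfl
      · rw [Function.update_of_ne hx'.ne, h x (not_le.1 (show ¬ x ≤ γ from hx)).le hx']
      · rw [Function.update_self]
  · rcases eq_or_ne α last with rfl | hα
    · simp
    · simp [hα]

/-- The jump at `ω₁` of the final column. -/
noncomputable def finalJump (T : BoundedOperators 𝕜) : 𝕜 :=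
  (exists_matrixColumn_last_eq T).choose

theorem finalJump_spec (T : BoundedOperators 𝕜) : ∃ g : C(OrdinalInterval, 𝕜),
    ∀ α, matrixColumn T last α = g α + if α = last then finalJump T else 0 :=
  (exists_matrixColumn_last_eq T).choose_spec

theorem finalJump_eq {T : BoundedOperators 𝕜} {c : 𝕜} {g : C(OrdinalInterval, 𝕜)}
    (h : ∀ α, matrixColumn T last α = g α + if α = last then c else 0) : finalJump T = c := by
  obtain ⟨g', h'⟩ := finalJump_spec T
  exact eq_of_ite_add g'.continuous.continuousAt g.continuous.continuousAt
    fun α => (h' α).symm.trans (h α)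

theorem mem_loyWillis_iff {T : BoundedOperators 𝕜} : T ∈ loyWillis 𝕜 ↔ finalJump T = 0 := by
  obtain ⟨g, hg⟩ := finalJump_spec T
  refine ⟨fun h => ?_, fun h => ?_⟩
  · exact eq_of_ite_add (d := 0) g.continuous.continuousAt h fun α => by simp [hg α]
  · have : matrixColumn T last = g := funext fun α => by simp [hg α, h]
    change ContinuousAt _ _
    rw [this]
    exact g.continuous.continuousAt

theorem finalJump_add (S T : BoundedOperators 𝕜) :
    finalJump (S + T) = finalJump S + finalJump T := by
  obtain ⟨g, hg⟩ := finalJump_spec S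
  obtain ⟨h, hh⟩ := finalJump_spec T
  refine finalJump_eq (g := g + h) fun α => matrixColumn_last_eq ?_
  filter_upwards [eventually_apply_eq_matrixColumn S α, eventually_apply_eq_matrixColumn T α]
    with β h1 h2
  rw [_root_.add_apply, ContinuousMap.add_apply, h1, h2, hg, hh,
    ContinuousMap.add_apply]
  split_ifs <;> ring

theorem finalJump_smul (c : 𝕜) (T : BoundedOperators 𝕜) :
    finalJump (c • T) = c • finalJump T := by
  obtain ⟨g, hg⟩ := finalJump_spec T
  refine finalJump_eq (g := c • g) fun α => matrixColumn_last_eq ?_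
  filter_upwards [eventually_apply_eq_matrixColumn T α] with β h1
  rw [_root_.smul_apply, ContinuousMap.smul_apply, h1, hg,
    ContinuousMap.smul_apply, smul_add, smul_ite, smul_zero]

theorem finalJump_one : finalJump (1 : BoundedOperators 𝕜) = 1 := by
  refine finalJump_eq (g := 0) fun α => matrixColumn_last_eq ?_
  rcases (le_last α).lt_or_eq with hα | rfl
  · refine eventually_nhdsLT_last_iff.2 ⟨α, hα, fun β h1 h2 => ?_⟩
    simp [initialIndicator_apply, h1, hα.ne]
  · refine eventually_nhdsLT_last_iff.2 ⟨_, zero_lt_last, fun β h1 h2 => ?_⟩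
    simp [initialIndicator_apply, h2.not_ge]

/-- For `β` good for every `x` in the countable support of row `α` of `S`, `T (1 - 1_[0,β])` can be
replaced there by the final column of `T`, that is `h` plus a jump at `ω₁`. Row `α` of `S` sends
this to `S h α` plus `finalJump T` times `S_{α,ω₁}`. -/
theorem finalJump_mul (S T : BoundedOperators 𝕜) :
    finalJump (S * T) = finalJump S * finalJump T := by
  obtain ⟨g, hg⟩ := finalJump_spec S
  obtain ⟨h, hh⟩ := finalJump_spec T
  refine finalJump_eq (g := S h + finalJump T • g) fun α => matrixColumn_last_eq ?_
  have hS := isMatrixOf_operatorMatrix S α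
  filter_upwards [(eventually_countable_ball hS.1.of_norm.countable_support).2
    fun x _ => eventually_apply_eq_matrixColumn T x] with β hβ
  rw [mul_apply_eq_comp]
  refine (hS.2 _).unique ?_
  have h1 := (hS.2 h).add (hasSum_ite_eq last (finalJump T * matrixColumn S last α))
  convert h1 using 1
  · funext x
    by_cases hx : operatorMatrix S α x = 0
    · rw [hx, zero_mul, zero_mul, zero_add]
      split_ifs with hl
      · subst hl
        rw [matrixColumn, hx, mul_zero]
      · rfl
    · rw [hβ x hx, hh x, matrixColumn]
      split_ifs with hl
      · subst hl
        ring
      · ring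
  · simp only [hg α, ContinuousMap.add_apply, ContinuousMap.smul_apply, smul_eq_mul]
    split_ifs <;> ring

/-- The jump of the final column, as a character of the algebra of bounded operators. -/
noncomputable def finalJumpHom (𝕜 : Type*) [RCLike 𝕜] : BoundedOperators 𝕜 →ₐ[𝕜] 𝕜 :=
  AlgHom.ofLinearMap
    { toFun := finalJump, map_add' := finalJump_add, map_smul' := finalJump_smul }
    finalJump_one finalJump_mul

/-! ### Factoring the identity through a closed unbounded set. -/

/-- A closed unbounded subset of `[0, ω₁]` is the image of a continuous map with a continuous left
inverse. -/
theorem exists_continuousMap_leftInverse {E : Set OrdinalInterval} (hE : IsClosed E)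
    (hlast : last ∈ E) (hub : ∀ γ < last, ∃ ξ ∈ E, γ < ξ ∧ ξ < last) :
    ∃ ψ p : C(OrdinalInterval, OrdinalInterval), (∀ i, ψ i ∈ E) ∧ ∀ i, p (ψ i) = i := by
  -- The tail `[ω₁,∞)` makes the set unbounded, as `Ordinal.enumOrd` needs.
  set s : Set Ordinal.{0} := Subtype.val '' E ∪ Ici ω₁ with hs
  have hsc : IsClosed s :=
    (_root_.isClosed_Icc.isClosedEmbedding_subtypeVal.isClosedMap _ hE).union _root_.isClosed_Ici
  have hsb : ¬ BddAbove s := by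
    rintro ⟨b, hb⟩
    have := hb (show max ω₁ (Order.succ b) ∈ s from Or.inr (mem_Ici.2 (le_max_left _ _)))
    exact absurd ((le_max_right _ _).trans this) (Order.lt_succ b).not_ge
  have hN := Ordinal.isNormal_enumOrd (s := s)
    (fun t ht hne hb => closure_minimal ht hsc (csSup_mem_closure hne hb)) hsb
  have hmono := Ordinal.enumOrd_strictMono hsb
  have hlt : ∀ i < ω₁, Ordinal.enumOrd s i < ω₁ := by
    intro i
    induction i using WellFoundedLT.induction with
    | ind i ih =>
    intro hi
    -- Countably many earlier values are bounded below `ω₁`, and `E` has a point above the bound.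
    -- The branch `last` is a dummy value.
    obtain ⟨γ, hγ, h⟩ := exists_lt_mem_of_countable
      (s := (fun j : OrdinalInterval => if h : Ordinal.enumOrd s j ≤ ω₁ then
        (⟨Ordinal.enumOrd s j, zero_le, h⟩ : OrdinalInterval) else last) ''
          {j | j.1 < i})
      ((countable_Iic_of_lt_last (α := ⟨i, zero_le, hi.le⟩) hi).mono
        (fun j hj => le_of_lt (α := Ordinal) hj) |>.image _) (by
          rintro _ ⟨j, hj, rfl⟩
          have := ih j hj (hj.trans hi)
          simp only [dif_pos this.le]
          exact this)
    obtain ⟨ξ, hξ, hγξ, hξl⟩ := hub γ hγ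
    refine lt_of_le_of_lt (Ordinal.enumOrd_le_of_forall_lt (a := ξ.1) (Or.inl ⟨ξ, hξ, rfl⟩)
      fun j hj => ?_) hξl
    have hj' := ih j hj (hj.trans hi)
    have := h _ ⟨⟨j, zero_le, (hj.trans hi).le⟩, hj, rfl⟩
    simp only [dif_pos hj'.le] at this
    exact lt_trans (α := Ordinal) this hγξ
  have hle : ∀ i ≤ ω₁, Ordinal.enumOrd s i ≤ ω₁ := by
    intro i hi
    rcases hi.lt_or_eq with h | rfl
    · exact (hlt i h).le
    · exact Ordinal.enumOrd_le_of_forall_lt (Or.inr self_mem_Ici) hlt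
  let ψ : C(OrdinalInterval, OrdinalInterval) :=
    ⟨fun i => ⟨Ordinal.enumOrd s i, zero_le, hle i i.2.2⟩,
      (hN.continuous.comp continuous_subtype_val).subtype_mk _⟩
  have hψ : StrictMono ψ := fun i j hij => hmono (show i.1 < j.1 from hij)
  have hψl : ψ last = last :=
    (le_last _).antisymm (show ω₁ ≤ Ordinal.enumOrd s ω₁ from Ordinal.le_enumOrd_self hsb)
  -- `p α` is the least `i` with `α ≤ ψ i`. This Galois connection turns preimages of open rays into
  -- complements or unions of clopen initial segments.
  have hp : ∀ α, ∃ q, ∀ i, q ≤ i ↔ α ≤ ψ i := by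
    intro α
    have hne : {i | α ≤ ψ i}.Nonempty := ⟨last, by simp [hψl, le_last]⟩
    refine ⟨wellFounded_lt.min _ hne, fun i => ⟨fun h => ?_, fun h => ?_⟩⟩
    · exact le_trans (wellFounded_lt.min_mem _ hne) (hψ.monotone h)
    · exact not_lt.1 (wellFounded_lt.not_lt_min (s := {i | α ≤ ψ i}) h)
  choose p hp using hp
  have hpc : Continuous p := by
    rw [OrderTopology.topology_eq_generate_intervals (α := OrdinalInterval),
      continuous_generateFrom_iff]
    rintro _ ⟨i, rfl | rfl⟩
    · have : p ⁻¹' Ioi i = (Iic (ψ i))ᶜ := by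
        ext α
        simp [← not_le, hp]
      rw [this, ← OrderTopology.topology_eq_generate_intervals]
      exact (isClopen_Iic _).compl.isOpen
    · have : p ⁻¹' Iio i = ⋃ j : Iio i, Iic (ψ j) := by
        ext α
        simp only [mem_preimage, mem_Iio, mem_iUnion, mem_Iic, ← hp]
        exact ⟨fun h => ⟨⟨p α, h⟩, le_rfl⟩, fun ⟨j, hj⟩ => hj.trans_lt j.2⟩
      rw [this, ← OrderTopology.topology_eq_generate_intervals]
      exact isOpen_iUnion fun j => (isClopen_Iic _).isOpen
  refine ⟨ψ, ⟨p, hpc⟩, fun i => ?_, fun i => ?_⟩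
  · rcases (le_last i).lt_or_eq with hi | rfl
    · rcases Ordinal.enumOrd_mem hsb i.1 with ⟨ξ, hξ, h⟩ | h
      · rwa [show ψ i = ξ from Subtype.ext h.symm]
      · exact absurd (hlt i.1 hi) (not_lt.2 h)
    · rwa [hψl]
  · refine le_antisymm ((hp _ _).2 le_rfl) ?_
    exact hψ.le_iff_le.1 ((hp _ _).1 le_rfl)

/-- If the final row and column of `T` are those of the identity, then evaluation of `T f` agrees
with evaluation of `f` on an unbounded set of points. -/
theorem exists_gt_apply_eq {T : BoundedOperators 𝕜} (hrow : ∀ f, T f last = f last)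
    (hcol : ∀ α < last, ∀ᶠ β in 𝓝[<] last, T (1 - initialIndicator 𝕜 β) α = 0)
    {γ₀ : OrdinalInterval} (hγ₀ : γ₀ < last) :
    ∃ ξ < last, γ₀ < ξ ∧ ∀ f, T f ξ = f ξ := by
  -- `δ` bounds both directions: rows up to `γ` kill `1 - 1_[0,β]` for `β ≥ δ`, and the images of
  -- `1_[0,β]`, `β ≤ γ`, vanish from `δ` on, being eventually equal to their value 0 at `ω₁`.
  have hF : ∀ γ : OrdinalInterval, ∃ δ < last, γ < last →
      (∀ α ≤ γ, ∀ β, δ ≤ β → T (1 - initialIndicator 𝕜 β) α = 0) ∧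
      ∀ β ≤ γ, ∀ α, δ ≤ α → T (initialIndicator 𝕜 β) α = 0 := by
    intro γ
    by_cases hγ : γ < last
    · obtain ⟨δ₁, h1, h1'⟩ := eventually_nhdsLT_last_iff.1
        ((eventually_countable_ball (countable_Iic_of_lt_last hγ)).2
          fun α hα => hcol α (lt_of_le_of_lt hα hγ))
      have hcon : ∀ β ∈ Iic γ, ∀ᶠ α in 𝓝[<] last, T (initialIndicator 𝕜 β) α = 0 := by
        intro β hβ
        obtain ⟨δ, h2, h3⟩ := eventually_eq_of_continuousAt_last
          (T (initialIndicator 𝕜 β)).continuous.continuousAt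
        refine eventually_nhdsLT_last_iff.2 ⟨δ, h2, fun α hα _ => ?_⟩
        rw [h3 α hα, hrow, initialIndicator_apply, if_neg (not_le.2 (lt_of_le_of_lt hβ hγ))]
      obtain ⟨δ₂, h2, h2'⟩ := eventually_nhdsLT_last_iff.1
        ((eventually_countable_ball (countable_Iic_of_lt_last hγ)).2 hcon)
      refine ⟨max δ₁ δ₂, max_lt h1 h2, fun _ => ⟨fun α hα β hβ => ?_, fun β hβ α hα => ?_⟩⟩
      · rcases (le_last β).lt_or_eq with h | rfl
        · exact h1' β ((le_max_left _ _).trans hβ) h α hα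
        · simp [initialIndicator_last]
      · rcases (le_last α).lt_or_eq with h | rfl
        · exact h2' α ((le_max_right _ _).trans hα) h β hβ
        · rw [hrow, initialIndicator_apply, if_neg (not_le.2 (hβ.trans_lt hγ))]
    · exact ⟨γ₀, hγ₀, fun h => absurd h hγ⟩
  choose F hF hF' using hF
  obtain ⟨α₀, hα₀, hone⟩ := eventually_eq_of_continuousAt_last (T 1).continuous.continuousAt
  obtain ⟨ξ, hξ, hξ₀, hcl⟩ := exists_closed_under F (fun γ _ => hF γ) (max_lt hγ₀ hα₀)
  refine ⟨ξ, hξ, (le_max_left _ _).trans_lt hξ₀, fun f => ?_⟩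
  have key : (ContinuousMap.evalCLM 𝕜 ξ).comp T =
      (ContinuousMap.evalCLM 𝕜 ξ : C(OrdinalInterval, 𝕜) →L[𝕜] 𝕜) := by
    refine continuousLinearMap_ext fun β => ?_
    change T (initialIndicator 𝕜 β) ξ = initialIndicator 𝕜 β ξ
    rw [initialIndicator_apply]
    rcases le_or_gt ξ β with hβ | hβ
    · rw [if_pos hβ]
      -- At points `α < ξ` close to `ξ`, `T 1_[0,β]` agrees with `T 1`, which is 1 beyond `α₀`;
      -- continuity carries the value 1 to `ξ`.
      refine eq_of_forall_dist_le fun ε hε => ?_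
      obtain ⟨δ, hδ, hδ'⟩ := exists_Ioc_subset_of_mem_nhds hξ₀
        ((T (initialIndicator 𝕜 β)).continuous.continuousAt (Metric.ball_mem_nhds _ hε))
      obtain ⟨α, hαξ, hα, -⟩ := hcl (max δ α₀) (max_lt hδ ((le_max_right _ _).trans_lt hξ₀))
      obtain ⟨γ, hγξ, hαγ, hγ⟩ := hcl α hαξ
      have h1 := (hF' γ (hγξ.trans hξ)).1 α hαγ.le β (hγ.le.trans hβ)
      rw [map_sub, ContinuousMap.sub_apply, hone α ((le_max_right _ _).trans hα.le), hrow,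
        ContinuousMap.one_apply, sub_eq_zero] at h1
      have h2 : dist (T (initialIndicator 𝕜 β) α) (T (initialIndicator 𝕜 β) ξ) < ε :=
        hδ' ⟨(le_max_left _ _).trans_lt hα, hαξ.le⟩
      rw [h1, dist_comm]
      exact h2.le
    · obtain ⟨γ, hγξ, hβγ, hγ⟩ := hcl β hβ
      rw [if_neg hβ.not_ge]
      exact (hF' γ (hγξ.trans hξ)).2 β hβγ.le ξ hγ.le
  exact congrArg (fun ν : C(OrdinalInterval, 𝕜) →L[𝕜] 𝕜 => ν f) key

/-- The composition operator `f ↦ f ∘ ψ`. -/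
theorem exists_compositionOperator (ψ : C(OrdinalInterval, OrdinalInterval)) :
    ∃ S : BoundedOperators 𝕜, ∀ f x, S f x = f (ψ x) := by
  let S : C(OrdinalInterval, 𝕜) →ₗ[𝕜] C(OrdinalInterval, 𝕜) :=
    { toFun := fun f => f.comp ψ, map_add' := fun _ _ => rfl, map_smul' := fun _ _ => rfl }
  refine ⟨S.mkContinuous 1 fun f => ?_, fun f x => rfl⟩
  rw [one_mul]
  exact (ContinuousMap.norm_le _ (norm_nonneg _)).2 fun x => f.norm_coe_le_norm _

theorem exists_mul_mul_eq_one {T : BoundedOperators 𝕜} (hrow : ∀ f, T f last = f last)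
    (hcol : ∀ α < last, ∀ᶠ β in 𝓝[<] last, T (1 - initialIndicator 𝕜 β) α = 0) :
    ∃ S R : BoundedOperators 𝕜, S * T * R = 1 := by
  have hE : IsClosed {x | ∀ f, T f x = f x} := by
    rw [ofPred_forall]
    exact isClosed_iInter fun f => isClosed_eq (T f).continuous f.continuous
  obtain ⟨ψ, p, hψ, hp⟩ := exists_continuousMap_leftInverse hE hrow fun γ hγ => by
    obtain ⟨ξ, h1, h2, h3⟩ := exists_gt_apply_eq hrow hcol hγ
    exact ⟨ξ, h3, h2, h1⟩
  obtain ⟨S, hS⟩ := exists_compositionOperator (𝕜 := 𝕜) ψ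
  obtain ⟨R, hR⟩ := exists_compositionOperator (𝕜 := 𝕜) p
  refine ⟨S, R, ContinuousLinearMap.ext fun f => ContinuousMap.ext fun x => ?_⟩
  change S (T (R f)) x = f x
  rw [hS, hψ x, hR, hp]

/-! ### Two-sided ideals. -/

variable {J : TwoSidedIdeal (BoundedOperators 𝕜)} {T : BoundedOperators 𝕜}

theorem smul_mem_twoSidedIdeal (hT : T ∈ J) (c : 𝕜) : c • T ∈ J := by
  have h : (c • 1 : BoundedOperators 𝕜) * T = c • T := rfl
  exact h ▸ J.mul_mem_left (c • 1) T hT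

/-- Sandwiching `T` between `ν ⊗ u` and evaluation at `x` tensored with `v` gives `T u x` times `ν ⊗
v`. -/
theorem smulRight_mem_twoSidedIdeal (hT : T ∈ J) (hT₀ : T ≠ 0)
    (ν : C(OrdinalInterval, 𝕜) →L[𝕜] 𝕜) (v : C(OrdinalInterval, 𝕜)) : ν.smulRight v ∈ J := by
  obtain ⟨u, x, hux⟩ : ∃ u x, T u x ≠ 0 := by
    by_contra! h
    exact hT₀ (ContinuousLinearMap.ext fun u => ContinuousMap.ext fun x => h u x)
  have h := smul_mem_twoSidedIdeal (J.mul_mem_right _ (ν.smulRight u)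
    (J.mul_mem_left ((ContinuousMap.evalCLM 𝕜 x).smulRight v) T hT)) (T u x)⁻¹
  convert h using 1
  ext f y
  change ν f * v y = (T u x)⁻¹ * (T (ν f • u) x * v y)
  rw [map_smul, ContinuousMap.smul_apply, smul_eq_mul]
  field_simp

theorem one_mem_twoSidedIdeal (hT : T ∈ J) (hc : finalJump T = 1) : 1 ∈ J := by
  obtain ⟨g, hg⟩ := finalJump_spec T
  rw [hc] at hg
  have hT₀ : T ≠ 0 := by
    rintro rfl
    exact one_ne_zero (hc.symm.trans (map_zero (finalJumpHom 𝕜)))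
  let e : C(OrdinalInterval, 𝕜) →L[𝕜] 𝕜 := ContinuousMap.evalCLM 𝕜 last
  -- The first correction removes `g` from the final column. The second makes the final row that of
  -- the identity and leaves the final column alone, because `T_{ω₁,ω₁} = g last + 1`.
  let U : BoundedOperators 𝕜 := T - e.smulRight g - (e.comp T - (g last + 1) • e).smulRight 1
  have hU : U ∈ J := J.sub_mem (J.sub_mem hT (smulRight_mem_twoSidedIdeal hT hT₀ _ _))
    (smulRight_mem_twoSidedIdeal hT hT₀ _ _)
  have hUa : ∀ f α, U f α =
      T f α - f last * g α - (T f last - (g last + 1) * f last) * 1 := fun _ _ => rfl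
  obtain ⟨S, R, h⟩ := exists_mul_mul_eq_one (T := U) (fun f => by rw [hUa]; ring)
    fun α hα => by
      filter_upwards [eventually_apply_eq_matrixColumn T α,
        eventually_apply_eq_matrixColumn T last, self_mem_nhdsWithin] with β h1 h2 h3
      rw [hUa, h1, h2, hg, hg, if_neg hα.ne, if_pos rfl, ContinuousMap.sub_apply,
        initialIndicator_apply, if_neg (not_le.2 h3), ContinuousMap.one_apply]
      ring
  exact h ▸ J.mul_mem_right _ _ (J.mul_mem_left _ _ hU)

theorem eq_top_of_finalJump_ne_zero (hT : T ∈ J) (hc : finalJump T ≠ 0) : J = ⊤ := by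
  refine J.one_mem_iff.1 (one_mem_twoSidedIdeal (smul_mem_twoSidedIdeal hT (finalJump T)⁻¹) ?_)
  rw [finalJump_smul, smul_eq_mul, inv_mul_cancel₀ hc]

/-- The Loy–Willis ideal. -/
noncomputable def loyWillisIdeal (𝕜 : Type*) [RCLike 𝕜] : TwoSidedIdeal (BoundedOperators 𝕜) :=
  TwoSidedIdeal.mk' {T | finalJump T = 0} (map_zero (finalJumpHom 𝕜))
    (fun {S T} hS hT => by
      rw [mem_ofPred_eq] at hS hT ⊢
      rw [finalJump_add, hS, hT, add_zero])
    (fun {T} hT => (map_neg (finalJumpHom 𝕜) T).trans (neg_eq_zero.2 hT))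
    (fun {S T} hT => (finalJump_mul S T).trans (mul_eq_zero_of_right _ hT))
    (fun {S T} hS => (finalJump_mul S T).trans (mul_eq_zero_of_left hS _))

theorem mem_loyWillisIdeal_iff : T ∈ loyWillisIdeal 𝕜 ↔ finalJump T = 0 :=
  TwoSidedIdeal.mem_mk' _ _ _ _ _ _ _

end OrdinalInterval

open OrdinalInterval in
theorem theorem1p1 (𝕜 : Type*) [RCLike 𝕜] :
    -- every operator has exactly one matrix, so that the columns are well defined
    (∀ T : BoundedOperators 𝕜,
      ∃! a : OrdinalInterval → OrdinalInterval → 𝕜, IsMatrixOf T a) ∧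
    -- `M` has codimension one, i.e. it is the kernel of a non-zero linear functional
    (∃ φ : BoundedOperators 𝕜 →ₗ[𝕜] 𝕜, φ ≠ 0 ∧ {T | φ T = 0} = loyWillis 𝕜) ∧
    -- `M` is a maximal two-sided ideal, and the only one
    (∃ M : TwoSidedIdeal (BoundedOperators 𝕜), (M : Set (BoundedOperators 𝕜)) = loyWillis 𝕜 ∧
      IsCoatom M ∧
      ∀ J : TwoSidedIdeal (BoundedOperators 𝕜), IsCoatom J → J = M) := by
  have hker : ∀ T : BoundedOperators 𝕜,
      T ∈ loyWillisIdeal 𝕜 ↔ finalJump T = 0 :=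
    fun T => mem_loyWillisIdeal_iff
  have htop : loyWillisIdeal 𝕜 ≠ ⊤ := by
    rw [Ne, ← TwoSidedIdeal.one_mem_iff, hker, finalJump_one]
    exact one_ne_zero
  have hle : ∀ J : TwoSidedIdeal (BoundedOperators 𝕜), J ≠ ⊤ →
      J ≤ loyWillisIdeal 𝕜 := fun J hJ T hT =>
    (hker T).2 (by_contra fun h => hJ (eq_top_of_finalJump_ne_zero hT h))
  refine ⟨existsUnique_isMatrixOf, ⟨(finalJumpHom 𝕜).toLinearMap, fun h => ?_, ?_⟩,
    loyWillisIdeal 𝕜, ?_, ⟨htop, fun J hJ => ?_⟩, fun J hJ => ?_⟩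
  · exact one_ne_zero (finalJump_one.symm.trans (LinearMap.congr_fun h (1 : BoundedOperators 𝕜)))
  · ext T
    exact mem_loyWillis_iff.symm
  · ext T
    exact (hker T).trans mem_loyWillis_iff.symm
  · exact by_contra fun h => hJ.not_ge (hle J h)
  · exact (hJ.le_iff.1 (hle J hJ.1)).resolve_left htop |>.symm
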